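/- Let $d\ge 3$ and $r>0$. Write $r\mathbf{B}^d=\{x\in\mathbb{R}^d:|x|\le r\}$ and $rS^{d-1}=\{x\in\mathbb{R}^d:|x|=r\}$. Let $P,Q\subset\mathbb{R}^d$ be two convex polytopes (convex hulls of finitely many points, with non-empty interior), both contained in the interior of $r\mathbf{B}^d$. For a set $K$ in the interior of $r\mathbf{B}^d$ and a point $z\in rS^{d-1}$ let $$K_z=\{x\in rS^{d-1}:\ xz\cap K\neq\emptyset\}$$ be the spherical projection of $K$ from $z$, where $xz=\{tx+(1-t)z:\ t\in[0,1]\}$ is the closed segment with end points $x$ and $z$. Assume that for every $z\in rS^{d-1}$ the sets $P_z$ and $Q_z$ are congruent, that is, there is an orthogonal transformation $\varphi_z\in O(d)$ with $\varphi_z(P_z)=Q_z$. Then $P=Q$. -/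

import Mathlib

/-- A convex polytope in `ℝ^d`: a convex body (so with non-empty interior) that is the convex
hull of finitely many points. -/
def IsConvexPolytope {d : ℕ} (P : Set (EuclideanSpace ℝ (Fin d))) : Prop :=
  (∃ S : Set (EuclideanSpace ℝ (Fin d)), S.Finite ∧ P = convexHull ℝ S) ∧ (interior P).Nonempty

/-- The spherical projection of `K` from the light source `z`: the points `x` of the sphere of
radius `r` centred at the origin whose closed segment to `z` meets `K`. -/
def sphericalProjection {d : ℕ} (r : ℝ) (K : Set (EuclideanSpace ℝ (Fin d)))
    (z : EuclideanSpace ℝ (Fin d)) : Set (EuclideanSpace ℝ (Fin d)) :=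
  {x | x ∈ Metric.sphere (0 : EuclideanSpace ℝ (Fin d)) r ∧ (segment ℝ x z ∩ K).Nonempty}

/-- Two sets are congruent by an orthogonal transformation (no translation). -/
def OrthogonallyCongruent {d : ℕ} (A B : Set (EuclideanSpace ℝ (Fin d))) : Prop :=
  ∃ φ : EuclideanSpace ℝ (Fin d) ≃ₗᵢ[ℝ] EuclideanSpace ℝ (Fin d), φ '' A = B

/-!
For a set `K` in the open ball, a point `x` of the sphere lies in the spherical projection of `K`
from `z` exactly if `x - z` lies in the visual cone of `K` at `z`, the set of positive multiples of
the vectors `k - z` with `k ∈ K`. The spherical projection is thus the trace on the sphere of a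
polyhedral cone with apex `z`, and two facts about such cones give the theorem.

*The trace determines the apex* (`apex_unique`), so the congruence `φ` belonging to `z` fixes `z`
(`congruence_fixes_apex`). Suppose that a polyhedral cone at `z` and one at `z'` have the same
trace, and let `H` be a supporting hyperplane of the cone at `z` that contains two of its rays, and
hence a circular arc of the trace. If `z'` were on the side of the cone, the circle through `z'`
and the end points of that arc would contribute to the trace an arc beyond `H`
(`apex_nonpos_of_two_points`). If `z'` were strictly
beyond `H`, take a point of the arc that is not on one of the finitely many edge rays of the cone at
`z'`; the trace contains an arc of a circle through that point and `z'`, and this circle either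
crosses `H` or is tangent to `H` and lies beyond it (`apex_nonneg_of_tangent`). So `z' ∈ H`. As the
dimension is at least three, a generic plane through the line `z z'` meets the boundary of the cone
in a ray that is not an edge, and the hyperplane supporting the cone there is of the kind
considered; it cannot contain `z'`, since the plane passes through interior points of the cone.

*Edge rays carry angles.* If `P` is not contained in `Q`, some vertex `p` of `P` is not in `Q`. For
all `z` in a nonempty open part of the sphere the ray `z p` is an exposed edge of the cone over `P`
(`eventually_exists_exposing`), so `φ` maps it to an edge of the cone over `Q`, which passes through
one of the finitely many points `w` spanning `Q` (`exists_angleDefect_eq_zero`). Since `φ` is an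
isometry fixing `z` and the centre, `p` and `w` are seen from `z` under the same angle with the
centre. For fixed `w ≠ p` this is a nontrivial algebraic condition on `z`, which fails on a dense
open part of the sphere (`eq_of_angleDefect_eq_zero`, `exists_forall_angleDefect_ne_zero`), and so
finitely many such conditions cannot cover an open part.
-/

/-! ### Visual cones and their traces on the sphere -/

section ConeBasics

variable {E : Type*} [NormedAddCommGroup E] [InnerProductSpace ℝ E]

open scoped RealInnerProductSpace

/-- The cone of all directions in which `K` is seen from `z`, the zero direction being left out:
the positive multiples of the vectors `k - z` with `k ∈ K`. -/
def visualCone (K : Set E) (z : E) : Set E :=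
  {u | ∃ k ∈ K, ∃ t : ℝ, 0 < t ∧ u = t • (k - z)}

theorem sub_mem_visualCone {K : Set E} {z k : E} (hk : k ∈ K) : k - z ∈ visualCone K z :=
  ⟨k, hk, 1, one_pos, (one_smul _ _).symm⟩

theorem visualCone_mono {K L : Set E} (h : K ⊆ L) (z : E) : visualCone K z ⊆ visualCone L z := by
  rintro u ⟨k, hk, t, ht, rfl⟩
  exact ⟨k, h hk, t, ht, rfl⟩

theorem smul_mem_visualCone {K : Set E} {z u : E} (hu : u ∈ visualCone K z) {s : ℝ}
    (hs : 0 < s) : s • u ∈ visualCone K z := by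
  obtain ⟨k, hk, t, ht, rfl⟩ := hu
  exact ⟨k, hk, s * t, mul_pos hs ht, by rw [smul_smul]⟩

theorem smul_mem_visualCone_iff {K : Set E} {z u : E} {s : ℝ} (hs : 0 < s) :
    s • u ∈ visualCone K z ↔ u ∈ visualCone K z := by
  refine ⟨fun h => ?_, fun h => smul_mem_visualCone h hs⟩
  have := smul_mem_visualCone h (inv_pos.2 hs)
  rwa [smul_smul, inv_mul_cancel₀ hs.ne', one_smul] at this

theorem add_mem_visualCone {K : Set E} (hK : Convex ℝ K) {z u v : E}
    (hu : u ∈ visualCone K z) (hv : v ∈ visualCone K z) : u + v ∈ visualCone K z := by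
  obtain ⟨k, hk, t, ht, rfl⟩ := hu
  obtain ⟨l, hl, s, hs, rfl⟩ := hv
  have hts : 0 < t + s := add_pos ht hs
  refine ⟨(t / (t + s)) • k + (s / (t + s)) • l, hK hk hl (by positivity) (by positivity)
    (by field_simp), t + s, hts, ?_⟩
  match_scalars <;> field_simp
  ring

theorem convex_visualCone {K : Set E} (hK : Convex ℝ K) (z : E) : Convex ℝ (visualCone K z) := by
  rw [convex_iff_forall_pos]
  intro u hu v hv a b ha hb _
  exact add_mem_visualCone hK (smul_mem_visualCone hu ha) (smul_mem_visualCone hv hb)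

theorem inner_sub_neg {r : ℝ} {k z : E} (hz : ‖z‖ = r) (hk : ‖k‖ < r) : ⟪k - z, z⟫ < 0 := by
  have h1 := real_inner_le_norm k z
  have h2 := norm_nonneg k
  rw [inner_sub_left, real_inner_self_eq_norm_sq, hz]
  rw [hz] at h1
  nlinarith

theorem inner_neg_of_mem_visualCone {r : ℝ} {K : Set E} {z u : E} (hz : ‖z‖ = r)
    (hK : ∀ k ∈ K, ‖k‖ < r) (hu : u ∈ visualCone K z) : ⟪u, z⟫ < 0 := by
  obtain ⟨k, hk, t, ht, rfl⟩ := hu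
  rw [inner_smul_left]
  exact mul_neg_of_pos_of_neg (by simpa using ht) (inner_sub_neg hz (hK k hk))

/-- Lying in the spherical projection, in terms of directions. For `x = z` both sides fail, as
neither `z ∈ K` nor `0 ∈ visualCone K z`. -/
theorem segment_inter_nonempty_iff {r : ℝ} {K : Set E} {z x : E} (hz : ‖z‖ = r)
    (hK : ∀ k ∈ K, ‖k‖ < r) (hx : ‖x‖ = r) :
    (segment ℝ x z ∩ K).Nonempty ↔ x - z ∈ visualCone K z := by
  constructor
  · rintro ⟨k, ⟨a, b, ha, hb, hab, rfl⟩, hk⟩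
    rcases ha.eq_or_lt with rfl | ha
    · have hb1 : b = 1 := by linarith
      have := hK _ hk
      simp [hb1, hz] at this
    · refine ⟨_, hk, a⁻¹, inv_pos.2 ha, ?_⟩
      obtain rfl : b = 1 - a := by linarith
      rw [show a • x + (1 - a) • z - z = a • (x - z) by module, smul_smul,
        inv_mul_cancel₀ ha.ne', one_smul]
  · rintro ⟨k, hk, t, ht, hxk⟩
    have hkx : k - z = t⁻¹ • (x - z) := by
      rw [hxk, smul_smul, inv_mul_cancel₀ ht.ne', one_smul]
    have hti : 0 < t⁻¹ := inv_pos.2 ht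
    have hle : t⁻¹ ≤ 1 := by
      -- a point of the line beyond `x` lies outside the ball
      have h1 : ‖z + t⁻¹ • (x - z)‖ < r := by
        rw [← hkx, add_sub_cancel]; exact hK k hk
      have h2 : ‖z + t⁻¹ • (x - z)‖ ^ 2 = r ^ 2 + (t⁻¹ * t⁻¹ - t⁻¹) * ‖x - z‖ ^ 2 := by
        rw [norm_add_sq_real, norm_smul, inner_smul_right, inner_sub_right,
          real_inner_self_eq_norm_sq, norm_sub_sq_real, hx, hz, mul_pow, norm_sub_sq_real, hx, hz,
          real_inner_comm, Real.norm_eq_abs, sq_abs]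
        ring
      by_contra! hlt
      have h3 : 0 ≤ (t⁻¹ * t⁻¹ - t⁻¹) * ‖x - z‖ ^ 2 :=
        mul_nonneg (by nlinarith) (sq_nonneg _)
      have h4 := norm_nonneg (z + t⁻¹ • (x - z))
      nlinarith
    refine ⟨k, ⟨t⁻¹, 1 - t⁻¹, hti.le, by linarith, by ring, ?_⟩, hk⟩
    rw [show k = z + (k - z) by abel, hkx]
    module

/-- A ray from a point of a sphere into the open ball meets the sphere a second time. -/
theorem exists_norm_add_smul_eq {r : ℝ} {z u : E} (hz : ‖z‖ = r) (hu : ⟪u, z⟫ < 0) :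
    ∃ s : ℝ, 0 < s ∧ s * ‖u‖ ^ 2 = -2 * ⟪u, z⟫ ∧ ‖z + s • u‖ = r := by
  have hu0 : u ≠ 0 := by rintro rfl; simp at hu
  have hn : 0 < ‖u‖ := norm_pos_iff.2 hu0
  have hs : (-2 * ⟪u, z⟫ / ‖u‖ ^ 2) * ‖u‖ ^ 2 = -2 * ⟪u, z⟫ := by field_simp
  refine ⟨-2 * ⟪u, z⟫ / ‖u‖ ^ 2, div_pos (by linarith) (by positivity), hs, ?_⟩
  generalize -2 * ⟪u, z⟫ / ‖u‖ ^ 2 = s at hs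
  have hsq : ‖z + s • u‖ ^ 2 = r ^ 2 := by
    rw [norm_add_sq_real, norm_smul, inner_smul_right, hz, mul_pow, Real.norm_eq_abs, sq_abs,
      real_inner_comm]
    linear_combination s * hs
  rwa [sq_eq_sq₀ (norm_nonneg _) (hz ▸ norm_nonneg z)] at hsq

/-- Away from its apex, the visual cone of a compact set is closed. -/
theorem mem_visualCone_of_mem_closure {r : ℝ} {K : Set E} {z u : E} (hz : ‖z‖ = r)
    (hK : ∀ k ∈ K, ‖k‖ < r) (hKc : IsCompact K) (hu : u ∈ closure (visualCone K z))
    (huz : ⟪u, z⟫ < 0) : u ∈ visualCone K z := by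
  have hcl : IsClosed {v : E | ∃ k ∈ K, ⟪v, z⟫ • (k - z) = ⟪k - z, z⟫ • v} := by
    have := isCompact_iff_compactSpace.1 hKc
    have h1 : IsClosed {q : K × E | ⟪q.2, z⟫ • ((q.1 : E) - z) = ⟪(q.1 : E) - z, z⟫ • q.2} :=
      isClosed_eq (by fun_prop) (by fun_prop)
    convert isClosedMap_snd_of_compactSpace _ h1 using 1
    ext v
    simp
  have hsub : visualCone K z ⊆ {v : E | ∃ k ∈ K, ⟪v, z⟫ • (k - z) = ⟪k - z, z⟫ • v} := by
    rintro v ⟨k, hk, t, ht, rfl⟩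
    refine ⟨k, hk, ?_⟩
    rw [inner_smul_left, smul_smul, mul_comm]
    simp
  obtain ⟨k, hk, hku⟩ := closure_minimal hsub hcl hu
  have hkz := inner_sub_neg hz (hK k hk)
  refine ⟨k, hk, ⟪u, z⟫ / ⟪k - z, z⟫, div_pos_of_neg_of_neg huz hkz, ?_⟩
  rw [div_eq_inv_mul, mul_smul, hku, smul_smul, inv_mul_cancel₀ hkz.ne, one_smul]

/-- A direction towards a polytope either lies on the line through one of the generating points
(the sign of the factor is never needed), or lies in the
relative interior of a planar angle of directions towards the polytope. -/
theorem exists_eq_smul_or_exists_add {V : Set E} (hV : V.Finite) {z u : E}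
    (hzV : z ∉ V) (hu : u ∈ visualCone (convexHull ℝ V) z) :
    (∃ v ∈ V, ∃ t : ℝ, u = t • (v - z)) ∨
      ∃ a ∈ visualCone (convexHull ℝ V) z, ∃ c ∈ visualCone (convexHull ℝ V) z,
        u = a + c ∧ LinearIndependent ℝ ![a, c] := by
  have key : ∀ k ∈ convexHull ℝ V, (∃ v ∈ V, ∃ t : ℝ, k - z = t • (v - z)) ∨
      ∃ a ∈ visualCone (convexHull ℝ V) z, ∃ c ∈ visualCone (convexHull ℝ V) z,
        k - z = a + c ∧ LinearIndependent ℝ ![a, c] := by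
    clear hu
    induction V, hV using Set.Finite.induction_on with
    | empty => simp
    | @insert v V hv hV ih =>
      intro k hk
      rcases V.eq_empty_or_nonempty with rfl | hne
      · left
        refine ⟨v, by simp, 1, ?_⟩
        simp at hk
        simp [hk]
      have hsub : convexHull ℝ V ⊆ convexHull ℝ (insert v V) :=
        convexHull_mono (Set.subset_insert v V)
      rw [convexHull_insert hne, mem_convexJoin] at hk
      obtain ⟨v', hv', l, hl, α, β, hα, hβ, hαβ, rfl⟩ := hk
      obtain rfl : v' = v := hv'
      have hv'mem : v' ∈ convexHull ℝ (insert v' V) := subset_convexHull ℝ _ (Set.mem_insert _ _)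
      rcases hα.eq_or_lt with rfl | hα
      · obtain rfl : β = 1 := by linarith
        rw [zero_smul, zero_add, one_smul]
        rcases ih (fun h => hzV (Set.mem_insert_of_mem _ h)) l hl with
          ⟨w, hw, t, h⟩ | ⟨a, ha, c, hc, h⟩
        · exact Or.inl ⟨w, Set.mem_insert_of_mem _ hw, t, h⟩
        · exact Or.inr ⟨a, visualCone_mono hsub z ha, c, visualCone_mono hsub z hc, h⟩
      rcases hβ.eq_or_lt with rfl | hβ
      · obtain rfl : α = 1 := by linarith
        exact Or.inl ⟨v', Set.mem_insert _ _, 1, by simp⟩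
      obtain rfl : α = 1 - β := by linarith
      by_cases hli : LinearIndependent ℝ ![(1 - β) • (v' - z), β • (l - z)]
      · exact Or.inr ⟨_, smul_mem_visualCone (sub_mem_visualCone hv'mem) hα, _,
          smul_mem_visualCone (sub_mem_visualCone (hsub hl)) hβ, by module, hli⟩
      · left
        rw [LinearIndependent.pair_iff] at hli
        push Not at hli
        obtain ⟨x, y, hxy, hne0⟩ := hli
        have hvz : v' - z ≠ 0 := fun h => hzV (by simp [← sub_eq_zero.1 h])
        have hy : y ≠ 0 := by
          rintro rfl
          have hx : x ≠ 0 := fun h => hne0 h rfl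
          simp [hx, hα.ne', hvz] at hxy
        refine ⟨v', Set.mem_insert _ _, (1 - β) - x * (1 - β) / y, ?_⟩
        have h1 : β • (l - z) = -((x * (1 - β) / y) • (v' - z)) := by
          have h2 : y • (β • (l - z)) = y • -((x * (1 - β) / y) • (v' - z)) := by
            rw [eq_neg_of_add_eq_zero_right hxy, smul_neg, smul_smul, smul_smul,
              mul_div_cancel₀ _ hy]
          exact smul_right_injective E hy h2
        rw [show (1 - β) • v' + β • l - z = (1 - β) • (v' - z) + β • (l - z) by module, h1]
        module
  obtain ⟨k, hk, t, ht, rfl⟩ := hu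
  rcases key k hk with ⟨v, hv, s, h⟩ | ⟨a, ha, c, hc, h, hli⟩
  · exact Or.inl ⟨v, hv, t * s, by rw [h, smul_smul]⟩
  · refine Or.inr ⟨t • a, smul_mem_visualCone ha ht, t • c, smul_mem_visualCone hc ht,
      by rw [h, smul_add], ?_⟩
    rw [LinearIndependent.pair_iff] at hli ⊢
    intro x y hxy
    have := hli (x * t) (y * t) (by rwa [mul_smul, mul_smul])
    simpa [ht.ne'] using this

end ConeBasics

/-! ### Supporting hyperplanes of a cone and a second apex -/

section Apex

variable {E : Type*} [NormedAddCommGroup E] [InnerProductSpace ℝ E]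

open scoped RealInnerProductSpace

/-- A supporting hyperplane `{x | f (x - z) = 0}` of the cone at `z` that contains two points of
the common trace does not have `z'` on the side of the cone: otherwise the circular arc through
the two points that is seen from `z'` under the chord would bulge out of the cone at `z`. -/
theorem apex_nonpos_of_two_points {r : ℝ} {K K' : Set E} {z z' : E}
    (hK' : Convex ℝ K') (hK'r : ∀ k ∈ K', ‖k‖ < r) (hz' : ‖z'‖ = r)
    (hA : ∀ x, ‖x‖ = r → (x - z ∈ visualCone K z ↔ x - z' ∈ visualCone K' z'))
    {f : E →L[ℝ] ℝ} (hf : ∀ u ∈ visualCone K z, 0 ≤ f u)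
    {x y : E} (hx : ‖x‖ = r) (hy : ‖y‖ = r) (hxy : x ≠ y)
    (hxC : x - z ∈ visualCone K z) (hyC : y - z ∈ visualCone K z)
    (hfx : f (x - z) = 0) (hfy : f (y - z) = 0) : f (z' - z) ≤ 0 := by
  have hq := add_mem_visualCone hK' ((hA x hx).1 hxC) ((hA y hy).1 hyC)
  set q := (x - z') + (y - z') with hqdef
  have hqz := inner_neg_of_mem_visualCone hz' hK'r hq
  obtain ⟨s, hs, hsq, hn⟩ := exists_norm_add_smul_eq hz' hqz
  have h1 := hf _ ((hA _ hn).2 (by simpa using smul_mem_visualCone hq hs))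
  have h2 : f (z' + s • q - z) = (1 - 2 * s) * f (z' - z) := by
    have : z' + s • q - z = (1 - 2 * s) • (z' - z) + s • (x - z) + s • (y - z) := by
      rw [hqdef]; module
    rw [this]; simp [hfx, hfy]
  -- the midpoint of the chord lies inside the ball, so the arc is met beyond it
  have h3 : 1 < 2 * s := by
    have h4 : 0 < ‖x - y‖ ^ 2 := by
      have := norm_pos_iff.2 (sub_ne_zero.2 hxy); positivity
    have h5 : ‖q‖ ^ 2 + ‖x - y‖ ^ 2 = 2 * (‖x - z'‖ ^ 2 + ‖y - z'‖ ^ 2) := by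
      have := parallelogram_law_with_norm ℝ (x - z') (y - z')
      rw [show x - z' - (y - z') = x - y by abel, ← hqdef] at this
      linear_combination this
    have h6 : ‖x - z'‖ ^ 2 + ‖y - z'‖ ^ 2 = -2 * ⟪q, z'⟫ := by
      rw [norm_sub_sq_real, norm_sub_sq_real, hqdef, inner_add_left, inner_sub_left,
        inner_sub_left, real_inner_self_eq_norm_sq, hx, hy, hz']
      ring
    have h7 : ‖q‖ ^ 2 < (2 * s) * ‖q‖ ^ 2 := by linarith
    by_contra! h8
    have := mul_le_mul_of_nonneg_right h8 (sq_nonneg ‖q‖)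
    linarith
  rw [h2] at h1
  nlinarith

theorem eq_zero_and_nonneg_of_forall_quadratic_nonneg {L Q : ℝ}
    (h : ∀ t : ℝ, -1 < t → t < 1 → 0 ≤ L * t + Q * t ^ 2) : L = 0 ∧ 0 ≤ Q := by
  have hQ : 0 ≤ Q := by
    have h1 := h (1 / 2) (by norm_num) (by norm_num)
    have h2 := h (-(1 / 2)) (by norm_num) (by norm_num)
    nlinarith
  refine ⟨?_, hQ⟩
  by_contra hL
  have hL' : 0 < |L| := abs_pos.2 hL
  -- the linear term dominates at `t = -L / (2 * (|L| + Q))`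
  have hd : 0 < 2 * (|L| + Q) := by positivity
  have ht : |(-L) / (2 * (|L| + Q))| < 1 := by
    rw [abs_div, abs_neg, abs_of_pos hd, div_lt_one hd]; linarith
  have h1 := h _ (abs_lt.1 ht).1 (abs_lt.1 ht).2
  have h2 : L * (-L / (2 * (|L| + Q))) + Q * (-L / (2 * (|L| + Q))) ^ 2
      = -(L ^ 2 * (2 * |L| + Q)) / (2 * (|L| + Q)) ^ 2 := by
    field_simp
    ring
  rw [h2] at h1
  have h3 : 0 < L ^ 2 * (2 * |L| + Q) := by
    have := sq_abs L
    positivity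
  have h4 : -(L ^ 2 * (2 * |L| + Q)) / (2 * (|L| + Q)) ^ 2 < 0 :=
    div_neg_of_neg_of_pos (by linarith) (by positivity)
  linarith

/-- If a point of a supporting hyperplane `{x | f (x - z) = 0}` of the cone at `z` is seen from
`z'` in the relative interior of a planar angle, then `z'` does not lie strictly beyond the
hyperplane: a circle through `z'` and a point of the trace that is tangent there to the
hyperplane stays on the side of `z'`. -/
theorem apex_nonneg_of_tangent {r : ℝ} {K K' : Set E} {z z' : E}
    (hK' : Convex ℝ K') (hK'r : ∀ k ∈ K', ‖k‖ < r) (hz' : ‖z'‖ = r)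
    (hA : ∀ x, ‖x‖ = r → (x - z ∈ visualCone K z ↔ x - z' ∈ visualCone K' z'))
    {f : E →L[ℝ] ℝ} (hf : ∀ u ∈ visualCone K z, 0 ≤ f u)
    {b a c : E} (hb : ‖b‖ = r) (hfb : f (b - z) = 0)
    (ha : a ∈ visualCone K' z') (hc : c ∈ visualCone K' z') (hac : b - z' = a + c)
    (hli : LinearIndependent ℝ ![a, c]) : 0 ≤ f (z' - z) := by
  by_contra! hneg
  set q := a + c with hq
  set m := a - c with hm
  have hfq : f q = -f (z' - z) := by
    have : q = (b - z) - (z' - z) := by rw [← hac]; abel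
    rw [this, map_sub, hfb, zero_sub]
  have hqz : ‖q‖ ^ 2 = -2 * ⟪q, z'⟫ := by
    rw [← hac, norm_sub_sq_real, inner_sub_left, real_inner_self_eq_norm_sq, hb, hz']
    ring
  -- the condition that the second intersections of the rays in direction `q + τ • m` are not
  -- beyond the hyperplane
  have key : ∀ τ : ℝ, -1 < τ → τ < 1 →
      0 ≤ (2 * f (z' - z) * (⟪q, m⟫ + ⟪m, z'⟫) + ‖q‖ ^ 2 * f m) * τ
        + (f (z' - z) * ‖m‖ ^ 2 - 2 * f m * ⟪m, z'⟫) * τ ^ 2 := by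
    intro τ h1 h2
    have hn : q + τ • m ∈ visualCone K' z' := by
      have := add_mem_visualCone hK' (smul_mem_visualCone ha (show 0 < 1 + τ by linarith))
        (smul_mem_visualCone hc (show 0 < 1 - τ by linarith))
      convert this using 1
      rw [hq, hm]; module
    obtain ⟨s, hs, hsq, hsn⟩ :=
      exists_norm_add_smul_eq hz' (inner_neg_of_mem_visualCone hz' hK'r hn)
    have h3 := hf _ ((hA _ hsn).2 (by simpa using smul_mem_visualCone hn hs))
    rw [show z' + s • (q + τ • m) - z = (z' - z) + s • (q + τ • m) by abel] at h3
    simp only [map_add, map_smul, smul_eq_mul, hfq] at h3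
    have h4 := mul_nonneg h3 (sq_nonneg ‖q + τ • m‖)
    have h5 : ‖q + τ • m‖ ^ 2 = ‖q‖ ^ 2 + 2 * τ * ⟪q, m⟫ + τ ^ 2 * ‖m‖ ^ 2 := by
      rw [norm_add_sq_real, inner_smul_right, norm_smul, mul_pow, Real.norm_eq_abs, sq_abs]
      ring
    have h6 : ⟪q + τ • m, z'⟫ = ⟪q, z'⟫ + τ * ⟪m, z'⟫ := by
      rw [inner_add_left, inner_smul_left]; simp
    rw [h6] at hsq
    have h7 : (f (z' - z) + s * (-f (z' - z) + τ * f m)) * ‖q + τ • m‖ ^ 2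
        = f (z' - z) * ‖q + τ • m‖ ^ 2
          + (s * ‖q + τ • m‖ ^ 2) * (-f (z' - z) + τ * f m) := by ring
    rw [h7, hsq, h5] at h4
    refine h4.trans_eq ?_
    linear_combination (f (z' - z) - τ * f m) * hqz
  obtain ⟨hL, hQ⟩ := eq_zero_and_nonneg_of_forall_quadratic_nonneg key
  have hCS : ⟪q, m⟫ ^ 2 < ‖q‖ ^ 2 * ‖m‖ ^ 2 := by
    rw [LinearIndependent.pair_iff] at hli
    have hq0 : q ≠ 0 := fun h => by simpa using (hli 1 1 (by rw [one_smul, one_smul, ← hq, h])).1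
    have hq2 : 0 < ‖q‖ ^ 2 := by have := norm_pos_iff.2 hq0; positivity
    have hv : ‖q‖ ^ 2 • m - ⟪q, m⟫ • q ≠ 0 := fun h => by
      obtain ⟨h1, h2⟩ := hli (‖q‖ ^ 2 - ⟪q, m⟫) (-‖q‖ ^ 2 - ⟪q, m⟫) (by
        rw [← h, hm]
        generalize ⟪q, a - c⟫ = i
        rw [hq]; module)
      linarith
    have hn : 0 < ‖‖q‖ ^ 2 • m - ⟪q, m⟫ • q‖ ^ 2 := by
      have := norm_pos_iff.2 hv; positivity
    rw [norm_sub_sq_real, norm_smul, norm_smul, inner_smul_left, inner_smul_right,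
      real_inner_comm, mul_pow, mul_pow, Real.norm_eq_abs, Real.norm_eq_abs, sq_abs, sq_abs] at hn
    simp only [conj_trivial] at hn
    have h1 : 0 < ‖q‖ ^ 2 * (‖q‖ ^ 2 * ‖m‖ ^ 2 - ⟪q, m⟫ ^ 2) := by
      refine hn.trans_eq ?_
      rw [real_inner_comm m q]
      ring
    have := pos_of_mul_pos_right h1 hq2.le
    linarith
  have h8 := mul_nonneg hQ (sq_nonneg ‖q‖)
  have h9 : (f (z' - z) * ‖m‖ ^ 2 - 2 * f m * ⟪m, z'⟫) * ‖q‖ ^ 2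
      = f (z' - z) * ((⟪q, m⟫ + 2 * ⟪m, z'⟫) ^ 2 + (‖q‖ ^ 2 * ‖m‖ ^ 2 - ⟪q, m⟫ ^ 2)) := by
    linear_combination (-2 * ⟪m, z'⟫) * hL
  rw [h9] at h8
  have h10 := mul_neg_of_neg_of_pos hneg
    (show 0 < (⟪q, m⟫ + 2 * ⟪m, z'⟫) ^ 2 + (‖q‖ ^ 2 * ‖m‖ ^ 2 - ⟪q, m⟫ ^ 2) by
      have := sq_nonneg (⟪q, m⟫ + 2 * ⟪m, z'⟫); linarith)
  linarith

/-- On the arc of the sphere cut out by the planar angle of `a` and `c` at `z` there is a point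
that does not lie on any of finitely many given lines through `z'`. -/
theorem exists_arc_point_avoiding {r : ℝ} {z z' a c : E} (hz : ‖z‖ = r) (hz' : ‖z'‖ = r)
    (ha : ⟪a, z⟫ < 0) (hc : ⟪c, z⟫ < 0) (hli : LinearIndependent ℝ ![a, c])
    {V : Set E} (hV : V.Finite) :
    ∃ l s : ℝ, 0 < l ∧ 0 < s ∧ ‖z + s • (a + l • c)‖ = r ∧
      (z + s • (a + l • c) ≠ z' →
        ∀ v ∈ V, ∀ t : ℝ, z + s • (a + l • c) - z' ≠ t • (v - z')) := by
  rw [LinearIndependent.pair_iff] at hli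
  have hneg : ∀ l : Set.Ioi (0 : ℝ), ⟪a + (l : ℝ) • c, z⟫ < 0 := by
    rintro ⟨l, hl⟩
    rw [inner_add_left, inner_smul_left]
    have := mul_neg_of_pos_of_neg (Set.mem_Ioi.1 hl) hc
    simpa using add_neg ha this
  choose s hs _ hn using fun l => exists_norm_add_smul_eq hz (hneg l)
  have hinj : Function.Injective fun l : Set.Ioi (0 : ℝ) => z + s l • (a + (l : ℝ) • c) := by
    intro l m hlm
    have h1 : s l • (a + (l : ℝ) • c) = s m • (a + (m : ℝ) • c) := add_left_cancel hlm
    obtain ⟨h2, h3⟩ := hli (s l - s m) (s l * l - s m * m) (by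
      rw [← sub_eq_zero] at h1
      rw [← h1]; module)
    have h4 : s l = s m := sub_eq_zero.1 h2
    rw [h4, ← mul_sub] at h3
    exact Subtype.ext (sub_eq_zero.1 ((mul_eq_zero.1 h3).resolve_left (hs m).ne'))
  have hinf : (Set.range fun l : Set.Ioi (0 : ℝ) => z + s l • (a + (l : ℝ) • c)).Infinite := by
    have : Infinite (Set.Ioi (0 : ℝ)) := (Set.Ioi_infinite (0 : ℝ)).to_subtype
    exact Set.infinite_range_of_injective hinj
  -- the second intersections of the given lines with the sphere
  obtain ⟨x, ⟨l, rfl⟩, hx⟩ := hinf.exists_notMem_finite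
    (hV.image fun v => z' + (-2 * ⟪v - z', z'⟫ / ‖v - z'‖ ^ 2) • (v - z'))
  refine ⟨l, s l, l.2, hs l, hn l, fun hne v hv t ht => hx ⟨v, hv, ?_⟩⟩
  have hxz : z + s l • (a + (l : ℝ) • c) = z' + t • (v - z') := by rw [← ht]; abel
  have ht0 : t ≠ 0 := by rintro rfl; exact hne (by simpa using hxz)
  have hv0 : v - z' ≠ 0 := fun h => hne (by simpa [h] using hxz)
  have hv1 : ‖v - z'‖ ^ 2 ≠ 0 := by simpa using hv0
  have h1 : ‖z' + t • (v - z')‖ ^ 2 = r ^ 2 := by rw [← hxz, hn l]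
  rw [norm_add_sq_real, norm_smul, inner_smul_right, hz', mul_pow, Real.norm_eq_abs, sq_abs,
    real_inner_comm] at h1
  have h2 : t = -2 * ⟪v - z', z'⟫ / ‖v - z'‖ ^ 2 := by
    rw [eq_div_iff hv1]
    apply mul_left_cancel₀ ht0
    linear_combination h1
  simp only [← h2]
  exact hxz.symm

end Apex

/-! ### Uniqueness of the apex -/

section ApexUnique

variable {E : Type*} [NormedAddCommGroup E] [InnerProductSpace ℝ E]

open scoped RealInnerProductSpace

/-- A supporting hyperplane of the cone at `z` that contains two directions of the cone passes
through the second apex `z'`. -/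
theorem apex_mem_supporting_hyperplane {r : ℝ} {K V' : Set E} {z z' : E}
    (hKr : ∀ k ∈ K, ‖k‖ < r) (hz : ‖z‖ = r)
    (hV' : V'.Finite) (hK'r : ∀ k ∈ convexHull ℝ V', ‖k‖ < r) (hz' : ‖z'‖ = r)
    (hKc : Convex ℝ K)
    (hA : ∀ x, ‖x‖ = r →
      (x - z ∈ visualCone K z ↔ x - z' ∈ visualCone (convexHull ℝ V') z'))
    {f : E →L[ℝ] ℝ} (hf : ∀ u ∈ visualCone K z, 0 ≤ f u) {a c : E}
    (ha : a ∈ visualCone K z) (hc : c ∈ visualCone K z) (hli : LinearIndependent ℝ ![a, c])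
    (hfa : f a = 0) (hfc : f c = 0) : f (z' - z) = 0 := by
  have hK' := convex_convexHull ℝ V'
  have haz := inner_neg_of_mem_visualCone hz hKr ha
  have hcz := inner_neg_of_mem_visualCone hz hKr hc
  refine le_antisymm ?_ ?_
  · obtain ⟨s, hs, -, hsn⟩ := exists_norm_add_smul_eq hz haz
    obtain ⟨t, ht, -, htn⟩ := exists_norm_add_smul_eq hz hcz
    refine apex_nonpos_of_two_points hK' hK'r hz' hA hf hsn htn ?_
      (by simpa using smul_mem_visualCone ha hs) (by simpa using smul_mem_visualCone hc ht)
      (by simp [hfa]) (by simp [hfc])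
    intro h
    have := (LinearIndependent.pair_iff.1 hli s (-t)
      (by rw [add_left_cancel h, neg_smul, add_neg_cancel])).1
    exact hs.ne' this
  · obtain ⟨l, s, hl, hs, hn, hav⟩ := exists_arc_point_avoiding hz hz' haz hcz hli hV'
    set b := z + s • (a + l • c) with hb
    have hbC : b - z ∈ visualCone K z := by
      rw [hb, add_sub_cancel_left]
      exact smul_mem_visualCone (add_mem_visualCone hKc ha (smul_mem_visualCone hc hl)) hs
    have hbC' := (hA b hn).1 hbC
    have hbz' : b ≠ z' := by
      intro h
      have := inner_neg_of_mem_visualCone hz' hK'r hbC'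
      simp [h] at this
    have hzV' : z' ∉ V' := fun h => (hK'r z' (subset_convexHull ℝ V' h)).ne hz'
    rcases exists_eq_smul_or_exists_add hV' hzV' hbC' with ⟨v, hv, t, h⟩ | ⟨a', ha', c', hc', h, h'⟩
    · exact absurd h (hav hbz' v hv t)
    · exact apex_nonneg_of_tangent hK' hK'r hz' hA hf hn (by simp [hb, hfa, hfc]) ha' hc' h h'

/-- A supporting functional at a boundary point of a convex cone, with its sign normalized to be
nonnegative on the cone. -/
theorem exists_supporting_functional {C : Set E} (hC : Convex ℝ C)
    (hsmul : ∀ u ∈ C, ∀ t : ℝ, 0 < t → t • u ∈ C) (hne : (interior C).Nonempty) {b : E}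
    (hb : b ∈ C) (hbi : b ∉ interior C) :
    ∃ f : E →L[ℝ] ℝ, (∀ u ∈ C, 0 ≤ f u) ∧ (∀ u ∈ interior C, 0 < f u) ∧ f b = 0 := by
  obtain ⟨g, hg⟩ := geometric_hahn_banach_open_point hC.interior isOpen_interior hbi
  have hle : ∀ u ∈ C, g u ≤ g b := by
    have h1 : closure (interior C) ⊆ {u | g u ≤ g b} :=
      closure_minimal (fun u hu => (hg u hu).le) (isClosed_le g.continuous continuous_const)
    intro u hu
    refine h1 ?_
    rw [hC.closure_interior_eq_closure_of_nonempty_interior hne]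
    exact subset_closure hu
  have hb0 : g b = 0 := by
    have h2 := hle _ (hsmul b hb 2 (by norm_num))
    have h3 := hle _ (hsmul b hb (1 / 2) (by norm_num))
    simp only [map_smul, smul_eq_mul] at h2 h3
    linarith
  refine ⟨-g, fun u hu => ?_, fun u hu => ?_, ?_⟩
  · have := hle u hu; simp; linarith
  · have := hg u hu; simp; linarith
  · simp [hb0]

variable [FiniteDimensional ℝ E]

/-- In dimension at least three, finitely many planes do not cover a nonempty open set. -/
theorem exists_mem_forall_notMem_span_pair (hd : 3 ≤ Module.finrank ℝ E) {O : Set E}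
    (hO : IsOpen O) (hne : O.Nonempty) (u : E) {V : Set E} (hV : V.Finite) :
    ∃ e ∈ O, ∀ v ∈ V, e ∉ Submodule.span ℝ {u, v} := by
  borelize E
  have h0 : MeasureTheory.Measure.addHaar (⋃ v ∈ V, (Submodule.span ℝ {u, v} : Set E)) = 0 := by
    rw [MeasureTheory.measure_biUnion_null_iff hV.countable]
    intro v _
    refine MeasureTheory.Measure.addHaar_submodule _ _ fun h => ?_
    have h1 : Module.finrank ℝ (Submodule.span ℝ {u, v} : Submodule ℝ E) ≤ 2 := by
      classical
      have := finrank_span_finset_le_card (R := ℝ) ({u, v} : Finset E)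
      rw [Set.finrank] at this
      rw [Finset.coe_pair] at this
      exact this.trans Finset.card_le_two
    rw [h, finrank_top] at h1
    omega
  by_contra! hcon
  have h1 : O ⊆ ⋃ v ∈ V, (Submodule.span ℝ {u, v} : Set E) := by
    intro e he
    obtain ⟨v, hv, h⟩ := hcon e he
    exact Set.mem_biUnion hv h
  exact (hO.measure_pos MeasureTheory.Measure.addHaar hne).ne'
    (MeasureTheory.measure_mono_null h1 h0)

/-- The apex of the visual cone of a polytope is determined by the trace of the cone on the
sphere. Otherwise the plane through both apexes `z`, `z'` and a generic interior direction `e` of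
the cone at `z` contains a boundary direction `b` of that cone that points at no vertex. A
supporting hyperplane at `b` then contains `z'`, hence the plane, hence the interior direction
`e`. -/
theorem apex_unique (hd : 3 ≤ Module.finrank ℝ E) {r : ℝ} {V V' : Set E} {z z' : E}
    (hV : V.Finite) (hKr : ∀ k ∈ convexHull ℝ V, ‖k‖ < r) (hz : ‖z‖ = r)
    (hint : (interior (convexHull ℝ V)).Nonempty)
    (hV' : V'.Finite) (hK'r : ∀ k ∈ convexHull ℝ V', ‖k‖ < r) (hz' : ‖z'‖ = r)
    (hA : ∀ x, ‖x‖ = r → (x - z ∈ visualCone (convexHull ℝ V) z ↔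
      x - z' ∈ visualCone (convexHull ℝ V') z')) : z' = z := by
  by_contra hne
  set K := convexHull ℝ V with hK
  have hKc : Convex ℝ K := convex_convexHull ℝ V
  set C := visualCone K z with hC
  have hzV : z ∉ V := fun h => (hKr z (subset_convexHull ℝ V h)).ne hz
  have hCi : (interior C).Nonempty := by
    obtain ⟨k, hk⟩ := hint
    refine ⟨k - z, mem_interior.2 ⟨(fun x => x + z) ⁻¹' interior K, fun u hu => ?_,
      isOpen_interior.preimage (by fun_prop), by simpa using hk⟩⟩
    simpa using sub_mem_visualCone (z := z) (interior_subset hu)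
  obtain ⟨e, he, hev⟩ := exists_mem_forall_notMem_span_pair hd isOpen_interior hCi (z' - z)
    (hV.image fun v => v - z)
  have hez := inner_neg_of_mem_visualCone hz hKr (interior_subset he)
  have huz : ⟪z' - z, z⟫ < 0 := by
    have h1 : 0 < ‖z' - z‖ ^ 2 := by have := norm_pos_iff.2 (sub_ne_zero.2 hne); positivity
    rw [norm_sub_sq_real, hz, hz'] at h1
    rw [inner_sub_left, real_inner_self_eq_norm_sq, hz]
    linarith
  have hu : z' - z ∉ C := fun h => by
    have := inner_neg_of_mem_visualCone hz' hK'r ((hA z' hz').1 h)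
    simp at this
  -- the segment from `e` to the direction of `z'` leaves the cone
  obtain ⟨b, ⟨α, β, hα, hβ, hαβ, rfl⟩, hbC, hbi⟩ :
      ∃ b ∈ segment ℝ e (z' - z), b ∈ C ∧ b ∉ interior C := by
    have hclos : ∀ b ∈ segment ℝ e (z' - z), b ∈ closure C → b ∈ C := by
      rintro b ⟨α, β, hα, hβ, hαβ, rfl⟩ hb
      refine mem_visualCone_of_mem_closure hz hKr (hV.isCompact_convexHull ℝ) hb ?_
      rw [inner_add_left, inner_smul_left, inner_smul_left]
      simp only [conj_trivial]
      rcases hα.eq_or_lt with rfl | hα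
      · obtain rfl : β = 1 := by linarith
        linarith
      · have := mul_neg_of_pos_of_neg hα hez
        have := mul_nonpos_of_nonneg_of_nonpos hβ huz.le
        linarith
    by_contra! hcon
    obtain ⟨b, hb, hb1, hb2⟩ := (convex_segment e (z' - z)).isPreconnected (interior C)
      (closure C)ᶜ isOpen_interior isClosed_closure.isOpen_compl
      (fun b hb => by
        by_cases h : b ∈ closure C
        · exact Or.inl (hcon b hb (hclos b hb h))
        · exact Or.inr h)
      ⟨e, left_mem_segment _ _ _, he⟩
      ⟨z' - z, right_mem_segment _ _ _, fun h => hu (hclos _ (right_mem_segment _ _ _) h)⟩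
    exact hb2 (subset_closure (interior_subset hb1))
  have hα0 : α ≠ 0 := by
    rintro rfl
    obtain rfl : β = 1 := by linarith
    simp only [zero_smul, one_smul, zero_add] at hbC
    exact hu hbC
  obtain ⟨f, hf, hfi, hfb⟩ := exists_supporting_functional (convex_visualCone hKc z)
    (fun u hu t ht => smul_mem_visualCone hu ht) hCi hbC hbi
  rcases exists_eq_smul_or_exists_add hV hzV hbC with ⟨v, hv, t, h⟩ | ⟨a, ha, c, hc, h, hli⟩
  · refine hev _ (Set.mem_image_of_mem _ hv) (Submodule.mem_span_pair.2 ⟨-(α⁻¹ * β), α⁻¹ * t, ?_⟩)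
    have h1 : α • e = t • (v - z) - β • (z' - z) := by rw [← h]; abel
    have h2 : e = α⁻¹ • (t • (v - z) - β • (z' - z)) := by
      rw [← h1, smul_smul, inv_mul_cancel₀ hα0, one_smul]
    conv_rhs => rw [h2]
    module
  · have hfa := hf a ha
    have hfc := hf c hc
    have hsum : f a + f c = 0 := by rw [← map_add, ← h, hfb]
    have hfu := apex_mem_supporting_hyperplane hKr hz hV' hK'r hz' hKc hA hf ha hc hli
      (by linarith) (by linarith)
    have hfe := hfi e he
    rw [map_add, map_smul, map_smul, hfu, smul_zero, add_zero, smul_eq_mul] at hfb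
    exact (mul_ne_zero hα0 hfe.ne') hfb

end ApexUnique

/-! ### Angles with the direction of the centre -/

section AngleFunctions

variable {E : Type*} [NormedAddCommGroup E] [InnerProductSpace ℝ E]

open scoped RealInnerProductSpace

/-- The difference of the squared cosines of the angles under which `w` and `p` are seen from `z`
relative to the centre `0`, with the denominators cleared. -/
def angleDefect (p w z : E) : ℝ :=
  ⟪w - z, z⟫ ^ 2 * ‖p - z‖ ^ 2 - ⟪p - z, z⟫ ^ 2 * ‖w - z‖ ^ 2

theorem angleDefect_eq {r : ℝ} {p w z : E} (hz : ‖z‖ = r) :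
    angleDefect p w z = (⟪w, z⟫ - r ^ 2) ^ 2 * (‖p‖ ^ 2 + r ^ 2 - 2 * ⟪p, z⟫)
      - (⟪p, z⟫ - r ^ 2) ^ 2 * (‖w‖ ^ 2 + r ^ 2 - 2 * ⟪w, z⟫) := by
  rw [angleDefect, inner_sub_left, inner_sub_left, real_inner_self_eq_norm_sq, norm_sub_sq_real,
    norm_sub_sq_real, hz]
  ring

theorem continuous_angleDefect (p w : E) : Continuous (angleDefect p w) := by
  unfold angleDefect
  fun_prop

/-- Along a great circle the angle defect is a trigonometric polynomial, so it vanishes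
identically once it vanishes near a point. -/
theorem angleDefect_circle_eq_zero {r : ℝ} {p w z f : E} (hz : ‖z‖ = r) (hf : ‖f‖ = r)
    (hzf : ⟪z, f⟫ = 0) {O : Set E} (hO : IsOpen O) (hzO : z ∈ O)
    (h : ∀ x ∈ O, ‖x‖ = r → angleDefect p w x = 0) (θ : ℝ) :
    angleDefect p w (Real.cos θ • z + Real.sin θ • f) = 0 := by
  have hnorm : ∀ θ : ℝ, ‖Real.cos θ • z + Real.sin θ • f‖ = r := by
    intro θ
    have h1 : ‖Real.cos θ • z + Real.sin θ • f‖ ^ 2 = r ^ 2 := by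
      rw [norm_add_sq_real, norm_smul, norm_smul, inner_smul_left, inner_smul_right, hzf, hz, hf,
        mul_pow, mul_pow, Real.norm_eq_abs, Real.norm_eq_abs, sq_abs, sq_abs]
      linear_combination r ^ 2 * Real.sin_sq_add_cos_sq θ
    rwa [sq_eq_sq₀ (norm_nonneg _) (hz ▸ norm_nonneg z)] at h1
  have han : AnalyticOnNhd ℝ
      (fun θ : ℝ => angleDefect p w (Real.cos θ • z + Real.sin θ • f)) Set.univ := by
    have heq : (fun θ : ℝ => angleDefect p w (Real.cos θ • z + Real.sin θ • f)) = fun θ : ℝ =>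
        (Real.cos θ * ⟪w, z⟫ + Real.sin θ * ⟪w, f⟫ - r ^ 2) ^ 2
          * (‖p‖ ^ 2 + r ^ 2 - 2 * (Real.cos θ * ⟪p, z⟫ + Real.sin θ * ⟪p, f⟫))
        - (Real.cos θ * ⟪p, z⟫ + Real.sin θ * ⟪p, f⟫ - r ^ 2) ^ 2
          * (‖w‖ ^ 2 + r ^ 2 - 2 * (Real.cos θ * ⟪w, z⟫ + Real.sin θ * ⟪w, f⟫)) := by
      funext θ
      rw [angleDefect_eq (hnorm θ)]
      simp only [inner_add_right, inner_smul_right]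
    rw [heq]
    intro x _
    fun_prop
  have hcont : Continuous fun θ : ℝ => Real.cos θ • z + Real.sin θ • f := by fun_prop
  refine han.eqOn_zero_of_preconnected_of_eventuallyEq_zero isPreconnected_univ
    (Set.mem_univ 0) ?_ (Set.mem_univ θ)
  filter_upwards [(hO.preimage hcont).mem_nhds (show (0 : ℝ) ∈ _ by simpa using hzO)] with x hx
  exact h _ hx (hnorm x)

variable [FiniteDimensional ℝ E]

theorem exists_norm_eq_orthogonal (hd : 3 ≤ Module.finrank ℝ E) {r : ℝ} (hr : 0 < r) (x y : E) :
    ∃ f : E, ‖f‖ = r ∧ ⟪x, f⟫ = 0 ∧ ⟪y, f⟫ = 0 := by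
  have h1 : Module.finrank ℝ (Submodule.span ℝ {x, y} : Submodule ℝ E) ≤ 2 := by
    classical
    have := finrank_span_finset_le_card (R := ℝ) ({x, y} : Finset E)
    rw [Set.finrank, Finset.coe_pair] at this
    exact this.trans Finset.card_le_two
  have h2 := Submodule.finrank_add_finrank_orthogonal (Submodule.span ℝ {x, y} : Submodule ℝ E)
  have h3 : (Submodule.span ℝ {x, y} : Submodule ℝ E)ᗮ ≠ ⊥ := fun h => by
    rw [h, finrank_bot] at h2
    omega
  obtain ⟨g, hg, hg0⟩ := Submodule.exists_mem_ne_zero_of_ne_bot h3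
  rw [Submodule.mem_orthogonal] at hg
  have hgx := hg x (Submodule.subset_span (by simp))
  have hgy := hg y (Submodule.subset_span (by simp))
  refine ⟨(r / ‖g‖) • g, ?_, by rw [inner_smul_right, hgx, mul_zero],
    by rw [inner_smul_right, hgy, mul_zero]⟩
  have := norm_pos_iff.2 hg0
  rw [norm_smul, Real.norm_eq_abs, abs_of_pos (by positivity)]
  field_simp

theorem exists_great_circle (hd : 3 ≤ Module.finrank ℝ E) {r : ℝ} (hr : 0 < r) {z x : E}
    (hz : ‖z‖ = r) (hx : ‖x‖ = r) :
    ∃ (f : E) (θ : ℝ), ‖f‖ = r ∧ ⟪z, f⟫ = 0 ∧ x = Real.cos θ • z + Real.sin θ • f := by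
  set θ := InnerProductGeometry.angle z x with hθ
  have hcos : r ^ 2 * Real.cos θ = ⟪z, x⟫ := by
    have := InnerProductGeometry.cos_angle_mul_norm_mul_norm z x
    rw [hz, hx, ← hθ] at this
    linear_combination this
  have hxz : ‖x - Real.cos θ • z‖ ^ 2 = (r * Real.sin θ) ^ 2 := by
    rw [norm_sub_sq_real, inner_smul_right, norm_smul, mul_pow, Real.norm_eq_abs, sq_abs, hz, hx,
      real_inner_comm, ← hcos]
    linear_combination -r ^ 2 * Real.sin_sq_add_cos_sq θ
  by_cases hs : Real.sin θ = 0
  · obtain ⟨f, hf, hzf, -⟩ := exists_norm_eq_orthogonal hd hr z z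
    refine ⟨f, θ, hf, hzf, ?_⟩
    rw [hs, mul_zero, zero_pow two_ne_zero, sq_eq_zero_iff, norm_eq_zero, sub_eq_zero] at hxz
    rw [hs, zero_smul, add_zero]
    exact hxz
  · refine ⟨(Real.sin θ)⁻¹ • (x - Real.cos θ • z), θ, ?_, ?_, ?_⟩
    · have h1 : ‖(Real.sin θ)⁻¹ • (x - Real.cos θ • z)‖ ^ 2 = r ^ 2 := by
        rw [norm_smul, mul_pow, hxz, Real.norm_eq_abs, sq_abs]
        field_simp
      rwa [sq_eq_sq₀ (norm_nonneg _) hr.le] at h1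
    · rw [inner_smul_right, inner_sub_right, inner_smul_right, real_inner_self_eq_norm_sq, hz,
        ← hcos]
      ring
    · rw [smul_smul, mul_inv_cancel₀ hs, one_smul, add_sub_cancel]

/-- Two points that are seen under equal angles with the direction of the centre from every
point of a sphere are equal. -/
theorem eq_of_angleDefect_eq_zero (hd : 3 ≤ Module.finrank ℝ E) {r : ℝ} (hr : 0 < r) {p w : E}
    (h : ∀ z : E, ‖z‖ = r → angleDefect p w z = 0) : p = w := by
  have h' := fun z hz => (angleDefect_eq (p := p) (w := w) hz).symm.trans (h z hz)
  have hnorm : ‖w‖ ^ 2 = ‖p‖ ^ 2 := by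
    obtain ⟨z, hz, hp, hw⟩ := exists_norm_eq_orthogonal hd hr p w
    have := h' z hz
    rw [hp, hw] at this
    have h1 : r ^ 4 * (‖w‖ ^ 2 - ‖p‖ ^ 2) = 0 := by linear_combination -this
    have := (mul_eq_zero.1 h1).resolve_left (by positivity)
    linarith
  by_cases hp0 : p = 0
  · rw [hp0] at hnorm ⊢
    simpa [eq_comm] using hnorm
  have hp : 0 < ‖p‖ := norm_pos_iff.2 hp0
  -- comparing the values at `z` and `-z`
  have hperp : ∀ z : E, ‖z‖ = r → ⟪p, z⟫ = 0 → ⟪w, z⟫ = 0 := by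
    intro z hz hpz
    have h1 := h' z hz
    have h2 := h' (-z) (by rwa [norm_neg])
    rw [inner_neg_right, inner_neg_right, hpz, hnorm] at h2
    rw [hpz, hnorm] at h1
    have h3 : ⟪w, z⟫ ^ 2 * (2 * (‖p‖ ^ 2 + r ^ 2)) = 0 := by linear_combination h1 + h2
    have := (mul_eq_zero.1 h3).resolve_right (by positivity)
    exact pow_eq_zero_iff two_ne_zero |>.1 this
  obtain ⟨c, hc⟩ : ∃ c : ℝ, w = c • p := by
    refine ⟨⟪p, w⟫ / ‖p‖ ^ 2, ?_⟩
    rw [← sub_eq_zero]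
    set y := w - (⟪p, w⟫ / ‖p‖ ^ 2) • p with hy
    by_contra hy0
    have hyn : 0 < ‖y‖ := norm_pos_iff.2 hy0
    have hpy : ⟪p, y⟫ = 0 := by
      rw [hy, inner_sub_right, inner_smul_right, real_inner_self_eq_norm_sq]
      field_simp
      ring
    have h1 := hperp ((r / ‖y‖) • y) (by
      rw [norm_smul, Real.norm_eq_abs, abs_of_pos (by positivity)]; field_simp)
      (by rw [inner_smul_right, hpy, mul_zero])
    rw [inner_smul_right] at h1
    have hwy := (mul_eq_zero.1 h1).resolve_left (by positivity)
    have h2 : ⟪y, y⟫ = 0 := by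
      conv_lhs => rw [hy]
      rw [← hy, inner_sub_left, hwy, inner_smul_left, hpy, mul_zero, sub_zero]
    exact hy0 (inner_self_eq_zero.1 h2)
  have hc2 : (c - 1) * (c + 1) = 0 := by
    rw [hc, norm_smul, mul_pow, Real.norm_eq_abs, sq_abs] at hnorm
    have h1 : ‖p‖ ^ 2 * ((c - 1) * (c + 1)) = 0 := by linear_combination hnorm
    exact (mul_eq_zero.1 h1).resolve_left (by positivity)
  rcases mul_eq_zero.1 hc2 with h1 | h1
  · rw [hc, sub_eq_zero.1 h1, one_smul]
  · exfalso
    obtain rfl : c = -1 := by linarith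
    obtain ⟨g, hg, hpg, -⟩ := exists_norm_eq_orthogonal hd hr p p
    -- any point of the sphere neither orthogonal nor parallel to `p` tells `p` from `-p`
    have hz : ‖(3 / 5 * (r / ‖p‖)) • p + (4 / 5 : ℝ) • g‖ = r := by
      have h2 : ‖(3 / 5 * (r / ‖p‖)) • p + (4 / 5 : ℝ) • g‖ ^ 2 = r ^ 2 := by
        rw [norm_add_sq_real, norm_smul, norm_smul, inner_smul_left, inner_smul_right, hpg, hg,
          mul_pow, mul_pow, Real.norm_eq_abs, Real.norm_eq_abs, sq_abs, sq_abs]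
        field_simp
        ring
      rwa [sq_eq_sq₀ (norm_nonneg _) hr.le] at h2
    have hpz : ⟪p, (3 / 5 * (r / ‖p‖)) • p + (4 / 5 : ℝ) • g⟫ = 3 / 5 * r * ‖p‖ := by
      rw [inner_add_right, inner_smul_right, inner_smul_right, hpg, real_inner_self_eq_norm_sq]
      field_simp
      ring
    have h2 := h' _ hz
    rw [hc, inner_smul_left, hpz, norm_smul] at h2
    simp only [map_neg, map_one, norm_neg, norm_one, one_mul, neg_mul] at h2
    have h3 : (r * ‖p‖) ^ 3 = 0 := by linear_combination (125 / 192) * h2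
    exact absurd h3 (by positivity)

/-- A point of the sphere from which `p` is seen under an angle different from those of
finitely many other points can be chosen in any open set that meets the sphere. -/
theorem exists_forall_angleDefect_ne_zero (hd : 3 ≤ Module.finrank ℝ E) {r : ℝ} (hr : 0 < r)
    {p : E} {W : Set E} (hW : W.Finite) (hpW : p ∉ W) {O : Set E} (hO : IsOpen O) {z₀ : E}
    (hz₀ : z₀ ∈ O) (hz₀r : ‖z₀‖ = r) :
    ∃ z ∈ O, ‖z‖ = r ∧ ∀ w ∈ W, angleDefect p w z ≠ 0 := by
  induction W, hW using Set.Finite.induction_on generalizing O z₀ with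
  | empty => exact ⟨z₀, hz₀, hz₀r, by simp⟩
  | @insert w W _ _ ih =>
    obtain ⟨z₁, hz₁, hz₁r, hne⟩ : ∃ z ∈ O, ‖z‖ = r ∧ angleDefect p w z ≠ 0 := by
      by_contra! hcon
      refine hpW (Set.mem_insert_iff.2 (Or.inl (eq_of_angleDefect_eq_zero hd hr fun x hx => ?_)))
      obtain ⟨f, θ, hf, hzf, rfl⟩ := exists_great_circle hd hr hz₀r hx
      exact angleDefect_circle_eq_zero hz₀r hf hzf hO hz₀ hcon θ
    obtain ⟨z, ⟨hzO, hzw⟩, hzr, hzW⟩ := ih (fun h => hpW (Set.mem_insert_of_mem _ h))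
      (hO.inter (isOpen_ne_fun (continuous_angleDefect p w) continuous_const)) ⟨hz₁, hne⟩ hz₁r
    refine ⟨z, hzO, hzr, fun v hv => ?_⟩
    rcases Set.mem_insert_iff.1 hv with rfl | hv
    · exact hzw
    · exact hzW v hv

end AngleFunctions

/-! ### Congruent traces determine the polytope -/

section Recognition

variable {E : Type*} [NormedAddCommGroup E] [InnerProductSpace ℝ E]

open scoped RealInnerProductSpace

/-- The functional `n` exposes the ray from `z` through `p` in the visual cone. -/
theorem eq_smul_of_inner_eq_zero {p z n : E} {V : Set E} (hp : ⟪n, p - z⟫ = 0)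
    (hV : ∀ v ∈ V, 0 < ⟪n, v - z⟫) {u : E} (hu : u ∈ visualCone (convexHull ℝ (insert p V)) z)
    (hnu : ⟪n, u⟫ = 0) : ∃ t : ℝ, u = t • (p - z) := by
  obtain ⟨k, hk, t, ht, rfl⟩ := hu
  refine ⟨t, ?_⟩
  rw [inner_smul_right] at hnu
  have hnk := (mul_eq_zero.1 hnu).resolve_left ht.ne'
  rcases V.eq_empty_or_nonempty with rfl | hne
  · simp at hk
    rw [hk]
  rw [convexHull_insert hne, mem_convexJoin] at hk
  obtain ⟨p', hp', l, hl, α, β, hα, hβ, hαβ, rfl⟩ := hk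
  obtain rfl : p' = p := hp'
  obtain rfl : α = 1 - β := by linarith
  have hconv : Convex ℝ {x : E | 0 < ⟪n, x - z⟫} := by
    have : {x : E | 0 < ⟪n, x - z⟫} = {x | ⟪n, z⟫ < innerₛₗ ℝ n x} := by
      ext x; simp [inner_sub_right]
    rw [this]
    exact convex_halfSpace_gt (innerₛₗ ℝ n).isLinear _
  have hl' : 0 < ⟪n, l - z⟫ := convexHull_min hV hconv hl
  rw [show (1 - β) • p' + β • l - z = (1 - β) • (p' - z) + β • (l - z) by module, inner_add_right,
    inner_smul_right, inner_smul_right, hp, mul_zero, zero_add] at hnk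
  rw [(mul_eq_zero.1 hnk).resolve_right hl'.ne']
  simp

/-- A rotation about the axis through `z` that matches the visual cones of two polytopes takes
an exposed ray to a ray through a generating point of the second polytope. -/
theorem exists_angleDefect_eq_zero {p z n : E} {V W : Set E} (hW : W.Finite) (hzW : z ∉ W)
    (hp : ⟪n, p - z⟫ = 0) (hV : ∀ v ∈ V, 0 < ⟪n, v - z⟫) (φ : E ≃ₗᵢ[ℝ] E) (hφ : φ z = z)
    (h : ∀ u, u ∈ visualCone (convexHull ℝ (insert p V)) z ↔
      φ u ∈ visualCone (convexHull ℝ W) z) :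
    ∃ w ∈ W, angleDefect p w z = 0 := by
  have hnonneg : ∀ u ∈ visualCone (convexHull ℝ (insert p V)) z, 0 ≤ ⟪n, u⟫ := by
    rintro u ⟨k, hk, t, ht, rfl⟩
    have hconv : Convex ℝ {x : E | ⟪n, z⟫ ≤ innerₛₗ ℝ n x} :=
      convex_halfSpace_ge (innerₛₗ ℝ n).isLinear _
    have hsub : insert p V ⊆ {x : E | ⟪n, z⟫ ≤ innerₛₗ ℝ n x} := by
      intro v hv
      rcases Set.mem_insert_iff.1 hv with rfl | hv
      · rw [inner_sub_right] at hp
        simpa using (sub_eq_zero.1 hp).ge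
      · have := hV v hv
        rw [inner_sub_right] at this
        simpa using (sub_pos.1 this).le
    have h1 := convexHull_min hsub hconv hk
    simp only [Set.mem_ofPred_eq, innerₛₗ_apply_apply] at h1
    rw [inner_smul_right, inner_sub_right]
    exact mul_nonneg ht.le (sub_nonneg.2 h1)
  have hpC := (h _).1 (sub_mem_visualCone (z := z)
    (subset_convexHull ℝ _ (Set.mem_insert p V)))
  rcases exists_eq_smul_or_exists_add hW hzW hpC with ⟨w, hw, t, ht⟩ | ⟨a, ha, c, hc, hac, hli⟩
  · refine ⟨w, hw, ?_⟩
    have h1 : ⟪p - z, z⟫ = t * ⟪w - z, z⟫ := by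
      rw [← φ.inner_map_map, ht, hφ, inner_smul_left]; simp
    have h2 : ‖p - z‖ ^ 2 = t ^ 2 * ‖w - z‖ ^ 2 := by
      rw [← φ.norm_map, ht, norm_smul, mul_pow, Real.norm_eq_abs, sq_abs]
    rw [angleDefect, h1, h2]
    ring
  · exfalso
    obtain ⟨a, rfl⟩ := φ.surjective a
    obtain ⟨c, rfl⟩ := φ.surjective c
    rw [← map_add] at hac
    have hac' := φ.injective hac
    rw [← h] at ha hc
    have h1 := hnonneg a ha
    have h2 := hnonneg c hc
    rw [hac', inner_add_right] at hp
    obtain ⟨s, hs⟩ := eq_smul_of_inner_eq_zero (hac' ▸ by rw [inner_add_right]; exact hp) hV ha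
      (by linarith)
    obtain ⟨t, ht⟩ := eq_smul_of_inner_eq_zero (hac' ▸ by rw [inner_add_right]; exact hp) hV hc
      (by linarith)
    rw [LinearIndependent.pair_iff] at hli
    have h3 := hli t (-s) (by
      rw [hs, ht, map_smul, map_smul, smul_smul, smul_smul]; module)
    have h4 := hli 1 0 (by
      rw [hs, neg_eq_zero.1 h3.2]; simp)
    exact one_ne_zero h4.1

/-- Being exposed is stable: if the ray from `z₀` through `p` is exposed in the visual cone of
`insert p V`, then so are the rays through `p` from all points near `z₀`. -/
theorem eventually_exists_exposing {p z₀ n₀ : E} {V : Set E} (hV : V.Finite) (hpz : p ≠ z₀)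
    (hp : ⟪n₀, p - z₀⟫ = 0) (hn : ∀ v ∈ V, 0 < ⟪n₀, v - p⟫) :
    ∀ᶠ z in nhds z₀, ∃ n : E, ⟪n, p - z⟫ = 0 ∧ ∀ v ∈ V, 0 < ⟪n, v - z⟫ := by
  -- correct `n₀` to a vector orthogonal to `p - z`
  have hne : ∀ᶠ z in nhds z₀, p - z ≠ 0 := by
    filter_upwards [isOpen_compl_singleton.mem_nhds hpz.symm] with z hz
    exact sub_ne_zero.2 fun h => hz h.symm
  have hpos : ∀ᶠ z in nhds z₀, ∀ v ∈ V,
      0 < ⟪n₀ - (⟪n₀, p - z⟫ / ‖p - z‖ ^ 2) • (p - z), v - p⟫ := by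
    rw [Filter.eventually_all_finite hV]
    intro v hv
    have hcont : ContinuousAt
        (fun z => ⟪n₀ - (⟪n₀, p - z⟫ / ‖p - z‖ ^ 2) • (p - z), v - p⟫) z₀ := by
      have : ‖p - z₀‖ ^ 2 ≠ 0 := by simpa [sub_eq_zero] using hpz
      fun_prop (disch := assumption)
    refine hcont.eventually (lt_mem_nhds ?_)
    simpa [hp] using hn v hv
  filter_upwards [hne, hpos] with z hz1 hz2
  have hz3 : ‖p - z‖ ^ 2 ≠ 0 := by simpa using hz1
  have h0 : ⟪n₀ - (⟪n₀, p - z⟫ / ‖p - z‖ ^ 2) • (p - z), p - z⟫ = 0 := by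
    rw [inner_sub_left, inner_smul_left, real_inner_self_eq_norm_sq]
    simp only [conj_trivial]
    field_simp
    ring
  refine ⟨_, h0, fun v hv => ?_⟩
  have := hz2 v hv
  rwa [show v - z = (v - p) + (p - z) by abel, inner_add_right, h0, add_zero]

variable [FiniteDimensional ℝ E]

/-- A point `p` outside the hull of `V` has a supporting hyperplane that strictly separates it
from `V`, and this hyperplane meets the sphere, so `p` is exposed as seen from some `z`. -/
theorem exists_norm_eq_exposing (hd : 3 ≤ Module.finrank ℝ E) {r : ℝ} (hr : 0 < r) {p : E}
    (hpr : ‖p‖ < r) {V : Set E} (hV : V.Finite) (hpV : p ∉ convexHull ℝ V) :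
    ∃ z n : E, ‖z‖ = r ∧ ⟪n, p - z⟫ = 0 ∧ ∀ v ∈ V, 0 < ⟪n, v - p⟫ := by
  obtain ⟨f, u, hfp, hfV⟩ := geometric_hahn_banach_point_closed (convex_convexHull ℝ V)
    (hV.isCompact_convexHull ℝ).isClosed hpV
  set n := (InnerProductSpace.toDual ℝ E).symm f
  have hn : ∀ x, ⟪n, x⟫ = f x := fun x => InnerProductSpace.toDual_symm_apply
  obtain ⟨g, hg, hng, -⟩ := exists_norm_eq_orthogonal hd hr n n
  have hcont : ContinuousOn (fun t : ℝ => ‖p + t • g‖) (Set.Icc 0 2) := by fun_prop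
  obtain ⟨t, -, ht⟩ := intermediate_value_Icc (by norm_num) hcont (show r ∈ _ by
    refine ⟨by simpa using hpr.le, ?_⟩
    have h1 := norm_sub_norm_le ((2 : ℝ) • g) (-p)
    rw [norm_smul, hg, norm_neg, sub_neg_eq_add, add_comm _ p] at h1
    simp only [Real.norm_ofNat] at h1
    show r ≤ ‖p + (2 : ℝ) • g‖
    linarith)
  refine ⟨p + t • g, n, ht, ?_, fun v hv => ?_⟩
  · rw [sub_add_cancel_left, inner_neg_right, inner_smul_right, hng, mul_zero, neg_zero]
  · rw [hn, map_sub]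
    have := hfV v (subset_convexHull ℝ V hv)
    linarith

/-- The congruence of two traces takes apex to apex. -/
theorem congruence_fixes_apex (hd : 3 ≤ Module.finrank ℝ E) {r : ℝ} {V W : Set E}
    (hV : V.Finite) (hVr : ∀ k ∈ convexHull ℝ V, ‖k‖ < r)
    (hW : W.Finite) (hWr : ∀ k ∈ convexHull ℝ W, ‖k‖ < r)
    (hint : (interior (convexHull ℝ W)).Nonempty) {z : E} (hz : ‖z‖ = r) (φ : E ≃ₗᵢ[ℝ] E)
    (h : ∀ x, ‖x‖ = r → (x - z ∈ visualCone (convexHull ℝ V) z ↔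
      φ x - z ∈ visualCone (convexHull ℝ W) z)) : φ z = z := by
  have himg : convexHull ℝ (φ '' V) = φ '' convexHull ℝ V :=
    (φ.toLinearEquiv.toLinearMap.image_convexHull V).symm
  refine apex_unique hd hW hWr hz hint (hV.image φ) ?_ (by rw [φ.norm_map, hz]) ?_
  · rw [himg]
    rintro _ ⟨k, hk, rfl⟩
    rw [φ.norm_map]
    exact hVr k hk
  · intro x hx
    obtain ⟨x, rfl⟩ := φ.surjective x
    rw [φ.norm_map] at hx
    rw [← h x hx, himg, ← map_sub]
    constructor
    · rintro ⟨k, hk, t, ht, hu⟩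
      exact ⟨φ k, Set.mem_image_of_mem _ hk, t, ht, by rw [hu, map_smul, map_sub]⟩
    · rintro ⟨_, ⟨k, hk, rfl⟩, t, ht, hu⟩
      exact ⟨k, hk, t, ht, φ.injective (by rw [hu, map_smul, map_sub])⟩

/-- If the visual cones of two polytopes cut congruent traces from the sphere at every apex, the
first polytope lies in the second. For an extreme point `p` of the first outside the second, the
angle between `p` and the centre would, from each of an open set of apexes, agree with that of
some generating point of the second. -/
theorem subset_of_congruent_traces (hd : 3 ≤ Module.finrank ℝ E) {r : ℝ} (hr : 0 < r)
    {V W : Set E} (hV : V.Finite) (hVr : ∀ k ∈ convexHull ℝ V, ‖k‖ < r)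
    (hW : W.Finite) (hWr : ∀ k ∈ convexHull ℝ W, ‖k‖ < r)
    (hint : (interior (convexHull ℝ W)).Nonempty)
    (h : ∀ z : E, ‖z‖ = r → ∃ φ : E ≃ₗᵢ[ℝ] E, ∀ x, ‖x‖ = r →
      (x - z ∈ visualCone (convexHull ℝ V) z ↔ φ x - z ∈ visualCone (convexHull ℝ W) z)) :
    convexHull ℝ V ⊆ convexHull ℝ W := by
  have hVc : Convex ℝ (convexHull ℝ V) := convex_convexHull ℝ V
  suffices hext : Set.extremePoints ℝ (convexHull ℝ V) ⊆ convexHull ℝ W by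
    rw [← closure_convexHull_extremePoints (hV.isCompact_convexHull ℝ) hVc]
    exact closure_minimal (convexHull_min hext (convex_convexHull ℝ W))
      (hW.isCompact_convexHull ℝ).isClosed
  intro p hp
  by_contra hpW
  have hpV := extremePoints_convexHull_subset hp
  have hpr := hVr p (subset_convexHull ℝ V hpV)
  have hins : insert p (V \ {p}) = V := by rw [Set.insert_sdiff_singleton, Set.insert_eq_of_mem hpV]
  have hpn : p ∉ convexHull ℝ (V \ {p}) := fun hmem =>
    (hVc.mem_extremePoints_iff_mem_sdiff_convexHull_sdiff.1 hp).2
      (convexHull_mono (Set.sdiff_subset_sdiff_left (subset_convexHull ℝ V)) hmem)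
  have hVp : (V \ {p}).Finite := hV.subset Set.sdiff_subset
  obtain ⟨z₀, n₀, hz₀, hp₀, hn₀⟩ := exists_norm_eq_exposing hd hr hpr hVp hpn
  have hpz₀ : p ≠ z₀ := by rintro rfl; exact hpr.ne hz₀
  obtain ⟨O, hO, hOopen, hz₀O⟩ :=
    mem_nhds_iff.1 (eventually_exists_exposing hVp hpz₀ hp₀ hn₀)
  obtain ⟨z, hzO, hz, hne⟩ := exists_forall_angleDefect_ne_zero hd hr hW
    (fun hmem => hpW (subset_convexHull ℝ W hmem)) hOopen hz₀O hz₀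
  obtain ⟨n, hn, hnV⟩ := hO hzO
  obtain ⟨φ, hφ⟩ := h z hz
  have hφz := congruence_fixes_apex hd hV hVr hW hWr hint hz φ hφ
  have hzW : z ∉ W := fun hmem => (hWr z (subset_convexHull ℝ W hmem)).ne hz
  obtain ⟨w, hw, hw0⟩ := exists_angleDefect_eq_zero (V := V \ {p}) hW hzW hn hnV φ hφz (by
    rw [hins]
    -- pass from directions to points of the sphere along the rays
    have key : ∀ u : E, ⟪u, z⟫ < 0 → (u ∈ visualCone (convexHull ℝ V) z ↔
        φ u ∈ visualCone (convexHull ℝ W) z) := by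
      intro u huz
      obtain ⟨s, hs, -, hsn⟩ := exists_norm_add_smul_eq hz huz
      have h1 := hφ _ hsn
      rwa [map_add, hφz, add_sub_cancel_left, add_sub_cancel_left, map_smul,
        smul_mem_visualCone_iff hs, smul_mem_visualCone_iff hs] at h1
    intro u
    refine ⟨fun hu => (key u (inner_neg_of_mem_visualCone hz hVr hu)).1 hu, fun hu => ?_⟩
    refine (key u ?_).2 hu
    have := inner_neg_of_mem_visualCone hz hWr hu
    rwa [← hφz, φ.inner_map_map] at this)
  exact hne w hw hw0

end Recognition

theorem theorem2 (d : ℕ) (hd : 3 ≤ d) (r : ℝ) (hr : 0 < r)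
    (P Q : Set (EuclideanSpace ℝ (Fin d)))
    (hP : IsConvexPolytope P) (hQ : IsConvexPolytope Q)
    (hPr : P ⊆ interior (Metric.closedBall (0 : EuclideanSpace ℝ (Fin d)) r))
    (hQr : Q ⊆ interior (Metric.closedBall (0 : EuclideanSpace ℝ (Fin d)) r))
    (h : ∀ z ∈ Metric.sphere (0 : EuclideanSpace ℝ (Fin d)) r,
      OrthogonallyCongruent (sphericalProjection r P z) (sphericalProjection r Q z)) :
    P = Q := by
  obtain ⟨⟨V, hV, rfl⟩, hPi⟩ := hP
  obtain ⟨⟨W, hW, rfl⟩, hQi⟩ := hQ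
  rw [interior_closedBall _ hr.ne'] at hPr hQr
  have hVr : ∀ k ∈ convexHull ℝ V, ‖k‖ < r := fun k hk => by simpa using hPr hk
  have hWr : ∀ k ∈ convexHull ℝ W, ‖k‖ < r := fun k hk => by simpa using hQr hk
  have hd' : 3 ≤ Module.finrank ℝ (EuclideanSpace ℝ (Fin d)) := by simpa using hd
  have hmem : ∀ (K : Set (EuclideanSpace ℝ (Fin d))), (∀ k ∈ K, ‖k‖ < r) → ∀ z, ‖z‖ = r →
      ∀ x, ‖x‖ = r → (x ∈ sphericalProjection r K z ↔ x - z ∈ visualCone K z) := by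
    intro K hK z hz x hx
    rw [← segment_inter_nonempty_iff hz hK hx]
    simp [sphericalProjection, hx]
  have hcong : ∀ z : EuclideanSpace ℝ (Fin d), ‖z‖ = r →
      ∃ φ : EuclideanSpace ℝ (Fin d) ≃ₗᵢ[ℝ] EuclideanSpace ℝ (Fin d), ∀ x, ‖x‖ = r →
        (x - z ∈ visualCone (convexHull ℝ V) z ↔
          φ x - z ∈ visualCone (convexHull ℝ W) z) := by
    intro z hz
    obtain ⟨φ, hφ⟩ := h z (by simpa using hz)
    refine ⟨φ, fun x hx => ?_⟩
    rw [← hmem _ hVr z hz x hx, ← hmem _ hWr z hz (φ x) (by rw [φ.norm_map, hx]), ← hφ,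
      φ.injective.mem_set_image]
  refine (subset_of_congruent_traces hd' hr hV hVr hW hWr hQi hcong).antisymm
    (subset_of_congruent_traces hd' hr hW hWr hV hVr hPi fun z hz => ?_)
  obtain ⟨φ, hφ⟩ := hcong z hz
  refine ⟨φ.symm, fun x hx => ?_⟩
  rw [hφ (φ.symm x) (by rw [φ.symm.norm_map, hx]), φ.apply_symm_apply]
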